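/- Let $R$ be a nonzero commutative ring, $n\ge 1$, and let $\lambda$ be a partition of $n$ with $\ell(\lambda)$ parts. For $k\ge 0$ let $\Xi_k$ be the $R$-algebra isomorphism from the ring of symmetric polynomials in $x_1,\dots,x_k$ over $R$ onto $R[t_1,\dots,t_k]$ with $\Xi_k(e_j)=(-1)^{j+1}t_j$ for $1\le j\le k$, where $e_j$ is the $j$-th elementary symmetric polynomial. The Schur reflect of $\lambda$ in $k$ variables is $\hat S_\lambda=\Xi_k(S_\lambda(x_1,\dots,x_k))$, where $S_\lambda$ is the Schur polynomial. For a weight vector $\omega=(\omega_1,\dots,\omega_k)\in R^k$ let $$P_{k,n,\omega}=\sum_{\alpha}A_\omega(\alpha)\,t_1^{\alpha_1}\cdots t_k^{\alpha_k},$$ where the sum is over all $\alpha\in\mathbb{Z}_{\ge0}^k$ with $\sum_j j\alpha_j=n$, and the coefficients are defined by induction on $|\alpha|=\sum_j\alpha_j$: the coefficient of $t_j$ is $\omega_j$, and for $|\alpha|\ge 2$, $A_\omega(\alpha)$ is the sum of $A_\omega(\beta)$ over all $\beta$ with $|\beta|=|\alpha|-1$ and $\beta_j\le\alpha_j$ for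 all $j$. Call $\lambda$ a hook if $\lambda=(p,1^q)$ for some $p\ge1$, $q\ge0$. 1. For every $k\ge\ell(\lambda)$: there is $\omega\in R^k$ with $\hat S_\lambda=P_{k,n,\omega}$ in $R[t_1,\dots,t_k]$ if and only if $\lambda$ is a hook. In particular, if $\lambda$ is not a hook, then $\hat S_\lambda\ne P_{k,n,\omega}$ for every weight vector $\omega$. 2. The same holds in infinitely many variables: there is a sequence $\omega=(\omega_1,\omega_2,\dots)$ in $R$ such that $\hat S_\lambda=P_{k,n,(\omega_1,\dots,\omega_k)}$ in $R[t_1,\dots,t_k]$ for every $k\ge0$ if and only if $\lambda$ is a hook. -/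

import Mathlib

/-! Partitions are Young diagrams `μ`, with `n = μ.card`, row lengths the parts of the partition and
`μ.colLen 0` the number of parts. The variables `x_1, …, x_k` and `t_1, …, t_k` are indexed by
`Fin k`, so that the index `j : Fin k` stands for the variable number `j + 1`. -/

namespace SchurReflect

open MvPolynomial

/-! ### Schur polynomials -/

/-- Semistandard tableaux of shape `μ` with entries in `{0, …, k - 1}`. -/
abbrev BoundedSSYT (k : ℕ) (μ : YoungDiagram) : Type :=
  {T : SemistandardYoungTableau μ // ∀ c : μ.cells, T c.1.1 c.1.2 < k}

instance (k : ℕ) (μ : YoungDiagram) : Finite (BoundedSSYT k μ) := by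
  let F : BoundedSSYT k μ → (μ.cells → Fin k) := fun T c => ⟨T.1 c.1.1 c.1.2, T.2 c⟩
  refine Finite.of_injective F ?_
  intro T T' h
  apply Subtype.ext
  ext i j
  by_cases hc : (i, j) ∈ μ
  · have := congrArg Fin.val (congrFun h ⟨(i, j), (YoungDiagram.mem_cells _).2 hc⟩)
    exact this
  · rw [T.1.zeros hc, T'.1.zeros hc]

noncomputable instance (k : ℕ) (μ : YoungDiagram) : Fintype (BoundedSSYT k μ) :=
  Fintype.ofFinite _

/-- The Schur polynomial `S_μ(x_1, …, x_k)`: the sum over the semistandard tableaux `T` of shape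
`μ`, with `k` possible entries, of the product of the variables at the entries of `T`. -/
noncomputable def schurPoly (R : Type*) [CommRing R] (k : ℕ) (μ : YoungDiagram) :
    MvPolynomial (Fin k) R :=
  ∑ T : BoundedSSYT k μ, ∏ c : μ.cells, X ⟨T.1 c.1.1 c.1.2, T.2 c⟩

/-! ### Schur polynomials are symmetric

The Bender–Knuth involution: in each row, the numbers of entries `a` and `a + 1` that are not
forced by a neighbouring row are exchanged. -/

section Symmetry

variable {μ : YoungDiagram}

/-- The number of entries smaller than `m` in row `i`. -/
def rowCount (T : SemistandardYoungTableau μ) (m i : ℕ) : ℕ :=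
  ((Finset.range (μ.rowLen i)).filter (fun j => T i j < m)).card

theorem rowCount_le (T : SemistandardYoungTableau μ) (m i : ℕ) :
    rowCount T m i ≤ μ.rowLen i := by
  simpa [rowCount] using Finset.card_filter_le (Finset.range (μ.rowLen i)) (fun j => T i j < m)

theorem lt_iff_rowCount (T : SemistandardYoungTableau μ) {m i j : ℕ} (h : (i, j) ∈ μ) :
    T i j < m ↔ j < rowCount T m i := by
  constructor
  · intro hT
    have : Finset.range (j + 1) ⊆ (Finset.range (μ.rowLen i)).filter (fun j => T i j < m) := by
      intro j' hj'
      have hj' : j' ≤ j := by simpa [Nat.lt_succ_iff] using hj'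
      have := YoungDiagram.mem_iff_lt_rowLen.1 h
      have := T.row_weak_of_le hj' h
      simp only [Finset.mem_filter, Finset.mem_range]
      omega
    have := Finset.card_le_card this
    simp only [Finset.card_range] at this
    exact this
  · intro hj
    by_contra hT
    have : (Finset.range (μ.rowLen i)).filter (fun j => T i j < m) ⊆ Finset.range j := by
      intro j' hj'
      simp only [Finset.mem_filter, Finset.mem_range] at hj' ⊢
      by_contra hlt
      have := T.row_weak_of_le (not_lt.1 hlt) (YoungDiagram.mem_iff_lt_rowLen.2 hj'.1)
      omega
    have := Finset.card_le_card this
    simp only [Finset.card_range] at this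
    exact absurd hj (not_lt.2 this)

theorem rowCount_eq (T : SemistandardYoungTableau μ) {m i f : ℕ} (hf : f ≤ μ.rowLen i)
    (h : ∀ j, (i, j) ∈ μ → (T i j < m ↔ j < f)) : rowCount T m i = f := by
  have hr := rowCount_le T m i
  rcases lt_trichotomy (rowCount T m i) f with hlt | heq | hlt
  · have hm : (i, rowCount T m i) ∈ μ := YoungDiagram.mem_iff_lt_rowLen.2 (by omega)
    have h1 := h _ hm
    have h2 := lt_iff_rowCount T (m := m) hm
    omega
  · exact heq
  · have hm : (i, f) ∈ μ := YoungDiagram.mem_iff_lt_rowLen.2 (by omega)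
    have h1 := h _ hm
    have h2 := lt_iff_rowCount T (m := m) hm
    omega

theorem rowCount_mono (T : SemistandardYoungTableau μ) (m i : ℕ) :
    rowCount T m i ≤ rowCount T (m + 1) i := by
  by_contra hlt
  have hm : (i, rowCount T (m + 1) i) ∈ μ :=
    YoungDiagram.mem_iff_lt_rowLen.2 (by have := rowCount_le T m i; omega)
  have h1 := lt_iff_rowCount T (m := m) hm
  have h2 := lt_iff_rowCount T (m := m + 1) hm
  omega

theorem rowCount_succ_row (T : SemistandardYoungTableau μ) (m i : ℕ) :
    rowCount T (m + 1) (i + 1) ≤ rowCount T m i := by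
  by_contra hlt
  have hm : (i + 1, rowCount T m i) ∈ μ :=
    YoungDiagram.mem_iff_lt_rowLen.2 (by have := rowCount_le T (m + 1) (i + 1); omega)
  have hm' : (i, rowCount T m i) ∈ μ := μ.up_left_mem (Nat.le_succ i) le_rfl hm
  have h1 := lt_iff_rowCount T (m := m + 1) hm
  have h2 := lt_iff_rowCount T (m := m) hm'
  have h3 := T.col_strict (show i < i + 1 by omega) hm
  omega

/-- The largest possible number of entries at most `a` in row `i`, all other entries being fixed. -/
def upper (T : SemistandardYoungTableau μ) (a : ℕ) : ℕ → ℕ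
  | 0 => rowCount T (a + 2) 0
  | i + 1 => min (rowCount T (a + 2) (i + 1)) (rowCount T a i)

/-- The least possible number of entries at most `a` in row `i`, all other entries being fixed. -/
def lower (T : SemistandardYoungTableau μ) (a i : ℕ) : ℕ :=
  max (rowCount T a i) (rowCount T (a + 2) (i + 1))

/-- The number of entries at most `a` in row `i` after the exchange. -/
def newCount (T : SemistandardYoungTableau μ) (a i : ℕ) : ℕ :=
  upper T a i + lower T a i - rowCount T (a + 1) i

theorem upper_le (T : SemistandardYoungTableau μ) (a i : ℕ) :
    rowCount T (a + 1) i ≤ upper T a i ∧ upper T a i ≤ rowCount T (a + 2) i := by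
  have h1 := rowCount_mono T (a + 1) i
  cases i with
  | zero => exact ⟨h1, le_rfl⟩
  | succ i =>
    have h2 := rowCount_succ_row T a i
    have h3 : rowCount T (a + 1) (i + 1) ≤ rowCount T (a + 2) (i + 1) := h1
    simp only [upper]
    omega

theorem lower_le (T : SemistandardYoungTableau μ) (a i : ℕ) :
    lower T a i ≤ rowCount T (a + 1) i := by
  have h1 := rowCount_mono T a i
  have h2 : rowCount T (a + 2) (i + 1) ≤ rowCount T (a + 1) i := rowCount_succ_row T (a + 1) i
  simp only [lower]
  omega

theorem newCount_bounds (T : SemistandardYoungTableau μ) (a i : ℕ) :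
    rowCount T a i ≤ newCount T a i ∧ newCount T a i ≤ rowCount T (a + 2) i ∧
      rowCount T (a + 2) (i + 1) ≤ newCount T a i ∧
      newCount T a (i + 1) ≤ rowCount T a i := by
  have h1 := upper_le T a i
  have h2 := lower_le T a i
  have h3 := upper_le T a (i + 1)
  have h4 := lower_le T a (i + 1)
  have h5 : upper T a (i + 1) ≤ rowCount T a i := by simp only [upper]; omega
  have h6 : rowCount T a i ≤ lower T a i ∧ rowCount T (a + 2) (i + 1) ≤ lower T a i := by
    simp only [lower]; omega
  simp only [newCount]
  omega

/-- The Bender–Knuth involution. -/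
def toggle (a : ℕ) (T : SemistandardYoungTableau μ) : SemistandardYoungTableau μ where
  entry i j :=
    if rowCount T a i ≤ j ∧ j < rowCount T (a + 2) i then
      (if j < newCount T a i then a else a + 1) else T i j
  row_weak' := by
    intro i j1 j2 hj h2
    have h1 : (i, j1) ∈ μ := μ.up_left_mem le_rfl hj.le h2
    have a1 := lt_iff_rowCount T (m := a) h1
    have a2 := lt_iff_rowCount T (m := a) h2
    have b1 := lt_iff_rowCount T (m := a + 2) h1
    have b2 := lt_iff_rowCount T (m := a + 2) h2
    have hw := T.row_weak hj h2
    split_ifs <;> omega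
  col_strict' := by
    intro i1 i2 j hi h2
    have h1 : (i1, j) ∈ μ := μ.up_left_mem hi.le le_rfl h2
    have hs : (i1 + 1, j) ∈ μ := μ.up_left_mem hi le_rfl h2
    obtain ⟨p, rfl⟩ : ∃ p, i2 = p + 1 := ⟨i2 - 1, by omega⟩
    have hp : (p, j) ∈ μ := μ.up_left_mem (Nat.le_succ p) le_rfl h2
    have a1 := lt_iff_rowCount T (m := a) h1
    have a2 := lt_iff_rowCount T (m := a) h2
    have a3 := lt_iff_rowCount T (m := a) hp
    have b1 := lt_iff_rowCount T (m := a + 2) h1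
    have b2 := lt_iff_rowCount T (m := a + 2) h2
    have b3 := lt_iff_rowCount T (m := a + 2) hs
    have hw := T.col_strict hi h2
    have hw1 := T.col_weak (i1 := i1 + 1) (i2 := p + 1) hi h2
    have hw2 := T.col_weak (i1 := i1) (i2 := p) (by omega) hp
    have n1 := newCount_bounds T a i1
    have n2 := newCount_bounds T a p
    split_ifs <;> omega
  zeros' := by
    intro i j h
    have := rowCount_le T (a + 2) i
    have h' : ¬ j < μ.rowLen i := fun hj => h (YoungDiagram.mem_iff_lt_rowLen.2 hj)
    rw [if_neg (by omega), T.zeros h]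

theorem toggle_apply (a : ℕ) (T : SemistandardYoungTableau μ) (i j : ℕ) :
    toggle a T i j = if rowCount T a i ≤ j ∧ j < rowCount T (a + 2) i then
      (if j < newCount T a i then a else a + 1) else T i j := rfl

theorem rowCount_toggle (a : ℕ) (T : SemistandardYoungTableau μ) (m i : ℕ) :
    rowCount (toggle a T) m i = if m = a + 1 then newCount T a i else rowCount T m i := by
  have hb := newCount_bounds T a i
  have hl := rowCount_le T (a + 2) i
  apply rowCount_eq
  · split_ifs
    · omega
    · exact rowCount_le T m i
  · intro j hj
    have a1 := lt_iff_rowCount T (m := a) hj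
    have a2 := lt_iff_rowCount T (m := a + 2) hj
    have a3 := lt_iff_rowCount T (m := m) hj
    rw [toggle_apply]
    split_ifs <;> omega

theorem toggle_toggle (a : ℕ) (T : SemistandardYoungTableau μ) : toggle a (toggle a T) = T := by
  have e0 : ∀ i, rowCount (toggle a T) a i = rowCount T a i := fun i => by
    rw [rowCount_toggle, if_neg (by omega)]
  have e1 : ∀ i, rowCount (toggle a T) (a + 1) i = newCount T a i := fun i => by
    rw [rowCount_toggle, if_pos rfl]
  have e2 : ∀ i, rowCount (toggle a T) (a + 2) i = rowCount T (a + 2) i := fun i => by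
    rw [rowCount_toggle, if_neg (by omega)]
  have en : ∀ i, newCount (toggle a T) a i = rowCount T (a + 1) i := by
    intro i
    have hu : upper (toggle a T) a i = upper T a i := by
      cases i <;> simp only [upper, e0, e2]
    have hl : lower (toggle a T) a i = lower T a i := by simp only [lower, e0, e2]
    have h1 := upper_le T a i
    have h2 := lower_le T a i
    rw [newCount, hu, hl, e1, newCount]
    omega
  ext i j
  rw [toggle_apply, e0, e2, en, toggle_apply]
  by_cases hj : (i, j) ∈ μ
  · have a1 := lt_iff_rowCount T (m := a) hj
    have a2 := lt_iff_rowCount T (m := a + 1) hj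
    have a3 := lt_iff_rowCount T (m := a + 2) hj
    split_ifs <;> omega
  · have := rowCount_le T (a + 2) i
    have h' : ¬ j < μ.rowLen i := fun hj' => hj (YoungDiagram.mem_iff_lt_rowLen.2 hj')
    rw [if_neg (by omega), if_neg (by omega)]

/-- The number of entries equal to `v`. -/
def content (T : SemistandardYoungTableau μ) (v : ℕ) : ℕ :=
  (μ.cells.filter (fun c => T c.1 c.2 = v)).card

theorem card_lt_eq (T : SemistandardYoungTableau μ) (m : ℕ) :
    (μ.cells.filter (fun c => T c.1 c.2 < m)).card =
      ∑ i ∈ Finset.range (μ.colLen 0), rowCount T m i := by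
  rw [Finset.card_eq_sum_card_fiberwise (f := Prod.fst) (t := Finset.range (μ.colLen 0))]
  · refine Finset.sum_congr rfl fun i _ => ?_
    rw [rowCount]
    symm
    refine Finset.card_bij (fun j _ => (i, j)) ?_ ?_ ?_
    · intro j hj
      simp only [Finset.mem_filter, Finset.mem_range, YoungDiagram.mem_cells,
        YoungDiagram.mem_iff_lt_rowLen, and_true] at hj ⊢
      exact hj
    · intro j _ j' _ h
      exact (Prod.mk.inj h).2
    · rintro ⟨i', j⟩ hj
      simp only [Finset.mem_filter, YoungDiagram.mem_cells,
        YoungDiagram.mem_iff_lt_rowLen] at hj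
      obtain ⟨⟨h1, h2⟩, rfl⟩ := hj
      exact ⟨j, by simp [h1, h2], rfl⟩
  · rintro ⟨i, j⟩ hc
    simp only [Finset.coe_filter, Set.mem_ofPred_eq, YoungDiagram.mem_cells] at hc
    simp only [Finset.coe_range, Set.mem_Iio]
    exact YoungDiagram.mem_iff_lt_colLen.1 (μ.up_left_mem le_rfl (Nat.zero_le _) hc.1)

theorem content_add (T : SemistandardYoungTableau μ) (v : ℕ) :
    content T v + ∑ i ∈ Finset.range (μ.colLen 0), rowCount T v i =
      ∑ i ∈ Finset.range (μ.colLen 0), rowCount T (v + 1) i := by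
  rw [← card_lt_eq, ← card_lt_eq, content, ← Finset.card_union_of_disjoint]
  · congr 1
    ext c
    simp only [Finset.mem_union, Finset.mem_filter]
    constructor
    · rintro (⟨h, h'⟩ | ⟨h, h'⟩)
      · exact ⟨h, by omega⟩
      · exact ⟨h, by omega⟩
    · rintro ⟨h, h'⟩
      rcases Nat.lt_succ_iff_lt_or_eq.1 h' with h'' | h''
      · exact Or.inr ⟨h, h''⟩
      · exact Or.inl ⟨h, h''⟩
  · rw [Finset.disjoint_filter]
    intro c _ h
    omega

theorem sum_upper_lower (T : SemistandardYoungTableau μ) (a L : ℕ) :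
    (∑ i ∈ Finset.range (L + 1), (upper T a i + lower T a i)) + rowCount T a L =
      (∑ i ∈ Finset.range (L + 1), (rowCount T (a + 2) i + rowCount T a i)) + lower T a L := by
  induction L with
  | zero => simp [upper]; omega
  | succ L ih =>
    rw [Finset.sum_range_succ, Finset.sum_range_succ (fun i => rowCount T (a + 2) i + _)]
    have : upper T a (L + 1) + lower T a L = rowCount T (a + 2) (L + 1) + rowCount T a L := by
      simp only [upper, lower]; omega
    omega

theorem sum_newCount (T : SemistandardYoungTableau μ) (a : ℕ) :
    (∑ i ∈ Finset.range (μ.colLen 0), newCount T a i) +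
      ∑ i ∈ Finset.range (μ.colLen 0), rowCount T (a + 1) i =
    (∑ i ∈ Finset.range (μ.colLen 0), rowCount T (a + 2) i) +
      ∑ i ∈ Finset.range (μ.colLen 0), rowCount T a i := by
  rw [← Finset.sum_add_distrib, ← Finset.sum_add_distrib]
  have h0 : ∀ i, newCount T a i + rowCount T (a + 1) i = upper T a i + lower T a i := by
    intro i
    have := upper_le T a i
    rw [newCount]; omega
  simp only [h0]
  rcases hL : μ.colLen 0 with _ | L
  · simp
  · have := sum_upper_lower T a L
    have hz : rowCount T (a + 2) (L + 1) = 0 := by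
      have h1 := rowCount_le T (a + 2) (L + 1)
      have h2 : ¬ 0 < μ.rowLen (L + 1) := by
        rw [← YoungDiagram.mem_iff_lt_rowLen, YoungDiagram.mem_iff_lt_colLen]
        omega
      omega
    have hl : lower T a L = rowCount T a L := by simp [lower, hz]
    omega

theorem content_toggle (a : ℕ) (T : SemistandardYoungTableau μ) (v : ℕ) :
    content (toggle a T) v = content T (Equiv.swap a (a + 1) v) := by
  have hn := sum_newCount T a
  have h := content_add (toggle a T) v
  simp only [rowCount_toggle] at h
  have c0 := content_add T a
  have c1 := content_add T (a + 1)
  have c2 := content_add T v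
  rw [show a + 1 + 1 = a + 2 from rfl] at c1
  by_cases h1 : v = a
  · subst h1
    rw [Equiv.swap_apply_left]
    simp at h
    omega
  · by_cases h2 : v = a + 1
    · subst h2
      rw [Equiv.swap_apply_right]
      simp at h
      omega
    · rw [Equiv.swap_apply_of_ne_of_ne h1 h2]
      simp only [h2, if_false, show ¬ (v + 1 = a + 1) by omega] at h
      omega

theorem toggle_lt {a k : ℕ} (ha : a + 1 < k) (T : SemistandardYoungTableau μ)
    (hT : ∀ c : μ.cells, T c.1.1 c.1.2 < k) (c : μ.cells) : toggle a T c.1.1 c.1.2 < k := by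
  have := hT c
  rw [toggle_apply]
  split_ifs <;> omega

theorem prod_eq_content (R : Type*) [CommRing R] {k : ℕ} (T : BoundedSSYT k μ) :
    (∏ c : μ.cells, X ⟨T.1 c.1.1 c.1.2, T.2 c⟩ : MvPolynomial (Fin k) R) =
      ∏ v : Fin k, X v ^ content T.1 v := by
  rw [← Finset.prod_fiberwise Finset.univ
    (fun c : μ.cells => (⟨T.1 c.1.1 c.1.2, T.2 c⟩ : Fin k))]
  refine Finset.prod_congr rfl fun v _ => ?_
  rw [Finset.prod_congr rfl (g := fun _ => X v), Finset.prod_const]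
  · congr 1
    rw [content]
    refine Finset.card_bij (fun c _ => c.1) ?_ ?_ ?_
    · intro c hc
      simp only [Finset.mem_filter, Finset.mem_univ, true_and] at hc
      simp only [Finset.mem_filter]
      exact ⟨c.2, congrArg Fin.val hc⟩
    · intro c _ c' _ h
      exact Subtype.ext h
    · intro c hc
      simp only [Finset.mem_filter] at hc
      exact ⟨⟨c, hc.1⟩, by simpa [Fin.ext_iff] using hc.2, rfl⟩
  · intro c hc
    simp only [Finset.mem_filter, Finset.mem_univ, true_and] at hc
    rw [hc]

theorem rename_swap_schurPoly (R : Type*) [CommRing R] {k : ℕ} (μ : YoungDiagram) (a : Fin k) :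
    rename (Equiv.swap a.castSucc a.succ) (schurPoly R (k + 1) μ) = schurPoly R (k + 1) μ := by
  have ha : (a : ℕ) + 1 < k + 1 := by omega
  have hval : ∀ v : Fin (k + 1), ((Equiv.swap a.castSucc a.succ v : Fin (k + 1)) : ℕ) =
      Equiv.swap (a : ℕ) (a + 1) v := by
    intro v
    simp only [Equiv.swap_apply_def, Fin.ext_iff, Fin.val_castSucc, Fin.val_succ]
    split_ifs <;> simp_all
  let e : BoundedSSYT (k + 1) μ ≃ BoundedSSYT (k + 1) μ :=
    { toFun := fun T => ⟨toggle a T.1, toggle_lt ha T.1 T.2⟩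
      invFun := fun T => ⟨toggle a T.1, toggle_lt ha T.1 T.2⟩
      left_inv := fun T => Subtype.ext (toggle_toggle _ _)
      right_inv := fun T => Subtype.ext (toggle_toggle _ _) }
  simp only [schurPoly, prod_eq_content, map_sum, map_prod, map_pow, rename_X]
  refine Fintype.sum_equiv e _ _ fun T => ?_
  refine Fintype.prod_equiv (Equiv.swap a.castSucc a.succ) _ _ fun v => ?_
  have : content (e T).1 (Equiv.swap a.castSucc a.succ v : Fin (k + 1)) = content T.1 v := by
    change content (toggle a T.1) _ = _
    rw [content_toggle, hval, Equiv.swap_apply_self]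
  rw [this]

end Symmetry

theorem schurPoly_isSymmetric (R : Type*) [CommRing R] (k : ℕ) (μ : YoungDiagram) :
    (schurPoly R k μ).IsSymmetric := by
  intro e
  cases k with
  | zero => rw [Subsingleton.elim e 1, Equiv.Perm.coe_one, rename_id_apply]
  | succ k =>
    have he : e ∈ Submonoid.closure
        (Set.range fun i : Fin k => Equiv.swap i.castSucc i.succ) := by
      rw [Equiv.Perm.mclosure_swap_castSucc_succ]; trivial
    induction he using Submonoid.closure_induction with
    | mem x hx =>
      obtain ⟨a, rfl⟩ := hx
      exact rename_swap_schurPoly R μ a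
    | one => rw [Equiv.Perm.coe_one, rename_id_apply]
    | mul x y _ _ hx hy => rw [Equiv.Perm.coe_mul, ← rename_rename, hy, hx]

/-! ### Isobaric reflects -/

/-- The automorphism `t_j ↦ (-1)^(j+1) t_j`, for `j = 1, …, k`, of `R[t_1, …, t_k]`. -/
noncomputable def signEquiv (R : Type*) [CommRing R] (k : ℕ) :
    MvPolynomial (Fin k) R ≃ₐ[R] MvPolynomial (Fin k) R :=
  AlgEquiv.ofAlgHom (aeval fun j : Fin k => (-1) ^ (j : ℕ) * X j)
    (aeval fun j : Fin k => (-1) ^ (j : ℕ) * X j)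
    (by ext j : 1; simp [← mul_assoc, ← mul_pow])
    (by ext j : 1; simp [← mul_assoc, ← mul_pow])

/-- The isomorphism `Ξ` from the ring of symmetric polynomials in `x_1, …, x_k` onto the ring
`R[t_1, …, t_k]` of isobaric polynomials, given by `e_j ↦ (-1)^(j+1) t_j` for `j = 1, …, k`. -/
noncomputable def reflection (R : Type*) [CommRing R] (k : ℕ) :
    symmetricSubalgebra (Fin k) R ≃ₐ[R] MvPolynomial (Fin k) R :=
  (esymmAlgEquiv (Fin k) R (Fintype.card_fin k)).symm.trans (signEquiv R k)

theorem reflection_esymm (R : Type*) [CommRing R] (k : ℕ) (j : Fin k) :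
    reflection R k ⟨esymm (Fin k) R (j + 1), esymm_isSymmetric (Fin k) R _⟩ =
      (-1) ^ (j : ℕ) * X j := by
  rw [reflection, AlgEquiv.trans_apply, esymmAlgEquiv_symm_apply]
  simp [signEquiv]

/-- The Schur reflect of `μ` in `t_1, …, t_k`. -/
noncomputable def schurReflect (R : Type*) [CommRing R] (k : ℕ) (μ : YoungDiagram) :
    MvPolynomial (Fin k) R :=
  reflection R k ⟨schurPoly R k μ, schurPoly_isSymmetric R k μ⟩

/-! ### Weighted isobaric polynomials -/

/-- The coefficient of `t^α`: it is `ω_j` for `t_j`, and at depth at least two it is the sum of the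
coefficients of all `t^β < t^α` whose depth is one less, that is, of all `t^α / t_j` with `t_j`
dividing `t^α`. -/
noncomputable def latticeWeight {R : Type*} [CommRing R] {k : ℕ} (ω : Fin k → R)
    (α : Fin k →₀ ℕ) : R :=
  if α.degree = 1 then ∑ j ∈ α.support, ω j
  else ∑ j : α.support, latticeWeight ω (α - Finsupp.single j.1 1)
termination_by α.degree
decreasing_by
  have hj : Finsupp.single j.1 1 ≤ α := by
    rw [Finsupp.single_le_iff]
    exact Nat.one_le_iff_ne_zero.2 (Finsupp.mem_support_iff.1 j.2)
  have h := congrArg Finsupp.degree (tsub_add_cancel_of_le hj)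
  rw [map_add, Finsupp.degree_single] at h
  omega

/-- The exponents `α` with `∑ j α_j = n`. -/
noncomputable def isobaricExponents (k n : ℕ) : Finset (Fin k →₀ ℕ) :=
  (Finsupp.finite_of_nat_weight_eq (fun j : Fin k => (j : ℕ) + 1)
    (fun j => Nat.succ_ne_zero j) n).toFinset

theorem mem_isobaricExponents {k n : ℕ} {α : Fin k →₀ ℕ} :
    α ∈ isobaricExponents k n ↔ ∑ j : Fin k, ((j : ℕ) + 1) * α j = n := by
  rw [isobaricExponents, Set.Finite.mem_toFinset, Set.mem_ofPred_eq, Finsupp.weight_apply,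
    Finsupp.sum_fintype _ _ (by simp)]
  simp [mul_comm]

/-- The weighted isobaric polynomial `P_{k,n,ω}` in `t_1, …, t_k`. -/
noncomputable def weightedIsobaric {R : Type*} [CommRing R] (k n : ℕ) (ω : Fin k → R) :
    MvPolynomial (Fin k) R :=
  ∑ α ∈ isobaricExponents k n, monomial α (latticeWeight ω α)

/-- `μ` is a hook, that is, the partition `(p, 1^q)` with `p ≥ 1`. -/
def IsHook (μ : YoungDiagram) : Prop :=
  ∃ p q : ℕ, 0 < p ∧ μ.rowLens = p :: List.replicate q 1

end SchurReflect

/-!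
Under `t_j ↦ (-1)^(j+1) e_j`, the inverse of the reflection, the Schur reflect goes back to the
Schur polynomial, and `P_{k,n,ω}` becomes `∑ (-1)^(j+1) ω_j e_j h_{n-j}`
(`aeval_weightedIsobaric`): its coefficients are defined by a linear recursion whose generating
function is inverse to `∑ (-1)^j e_j z^j`, like that of the complete homogeneous polynomials.
The coefficient of `x^α` in `e_j h_{n-j}` is the number of `j`-element subsets of the support of
`α`. So the question is whether, for some `ω`, the number of semistandard tableaux of shape `μ` and
content `α` is `∑ (-1)^(j+1) ω_j C(m, j)`, with `m` the size of the support of `α`, for all `α` of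
degree `n` (`schurReflect_eq_weightedIsobaric_iff`).

For the hook `(p, 1^q)` that number is `C(m - 1, q)` (`card_hook_tableaux`): a tableau is determined
by its leg, which is any set of `q` of the values that occur, the least value excepted. This is the
sum above for `ω_j = (-1)^q` if `j > q` and `ω_j = 0` otherwise, by telescoping
(`sum_neg_one_pow_choose`).

If `μ` is not a hook and has `ℓ` parts, then the exponents `μ` and `(n - ℓ + 1, 1^(ℓ-1))` have
supports of the same size. There is exactly one tableau with the first content, and none with the
second, as `n - ℓ + 1` exceeds the length of the first row. So an equality would force `1 = 0` in
`R` (`isHook_of_schurReflect_eq`).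
-/

namespace SchurReflect

open MvPolynomial

/-! ### Products of elementary and complete homogeneous polynomials -/

theorem coeff_hsymm {σ : Type*} [Fintype σ] [DecidableEq σ] (R : Type*) [CommRing R] (m : ℕ)
    (α : σ →₀ ℕ) : coeff α (hsymm σ R m) = if α.degree = m then 1 else 0 := by
  have hmon : ∀ s : Multiset σ,
      (s.map X).prod = (monomial (Multiset.toFinsupp s) 1 : MvPolynomial σ R) := by
    intro s
    induction s using Multiset.induction_on with
    | empty => simp
    | cons a s ih =>
      rw [Multiset.map_cons, Multiset.prod_cons, ih, ← Multiset.singleton_add, map_add,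
        Multiset.toFinsupp_singleton, X, monomial_mul, one_mul]
  have hcard : ∀ s : Multiset σ, (Multiset.toFinsupp s).degree = s.card := by
    intro s
    induction s using Multiset.induction_on with
    | empty => simp
    | cons a s ih =>
      rw [← Multiset.singleton_add, map_add, map_add, ih, Multiset.toFinsupp_singleton,
        Finsupp.degree_single, Multiset.card_add, Multiset.card_singleton]
  simp only [hsymm, coeff_sum, hmon, coeff_monomial]
  split_ifs with h
  · obtain ⟨s₀, hs₀⟩ : ∃ s : Sym σ m, (s : Multiset σ) = Finsupp.toMultiset α :=
      ⟨⟨Finsupp.toMultiset α, by rw [← hcard, Finsupp.toMultiset_toFinsupp, h]⟩, rfl⟩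
    refine (Finset.sum_eq_single s₀ ?_ ?_).trans (if_pos ?_)
    · intro s _ hne
      refine if_neg ?_
      rintro rfl
      exact hne (Subtype.ext ((Multiset.toFinsupp_toMultiset _).symm.trans hs₀.symm))
    · exact fun h' => absurd (Finset.mem_univ s₀) h'
    · exact (congrArg _ hs₀).trans (Finsupp.toMultiset_toFinsupp α)
  · refine Finset.sum_eq_zero fun s _ => if_neg ?_
    rintro rfl
    exact h ((hcard _).trans s.2)

/-- The coefficient of `x^α` in `e_j h_m` counts the sets of `j` variables dividing `x^α`, so it
depends only on the size of the support of `α`. -/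
theorem coeff_esymm_mul_hsymm {σ : Type*} [Fintype σ] [DecidableEq σ] (R : Type*) [CommRing R]
    (j m : ℕ) (α : σ →₀ ℕ) :
    coeff α (esymm σ R j * hsymm σ R m) =
      if α.degree = j + m then ((α.support.card.choose j : ℕ) : R) else 0 := by
  have hle : ∀ t : Finset σ, (∑ i ∈ t, Finsupp.single i 1 ≤ α ↔ t ⊆ α.support) := by
    intro t
    have hval : ∀ i, (∑ i ∈ t, Finsupp.single i 1 : σ →₀ ℕ) i = if i ∈ t then 1 else 0 := by
      intro i
      simp [Finsupp.finsetSum_apply, Finsupp.single_apply]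
    simp only [Finsupp.le_def, hval, Finset.subset_iff, Finsupp.mem_support_iff]
    refine forall_congr' fun i => ?_
    split_ifs with h <;> simp [h, Nat.one_le_iff_ne_zero]
  have hdeg : ∀ t : Finset σ, (∑ i ∈ t, Finsupp.single i 1 : σ →₀ ℕ).degree = t.card := by
    intro t; simp
  rw [esymm_eq_sum_monomial, Finset.sum_mul, coeff_sum]
  have hterm : ∀ t ∈ Finset.powersetCard j (Finset.univ : Finset σ),
      coeff α (monomial (∑ i ∈ t, Finsupp.single i 1) 1 * hsymm σ R m) =
        if t ⊆ α.support then (if α.degree = j + m then (1 : R) else 0) else 0 := by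
    intro t ht
    rw [coeff_monomial_mul']
    simp only [hle]
    by_cases h : t ⊆ α.support
    · rw [if_pos h, if_pos h, one_mul, coeff_hsymm]
      have hadd := congrArg Finsupp.degree (tsub_add_cancel_of_le ((hle t).2 h))
      rw [map_add, hdeg, (Finset.mem_powersetCard.1 ht).2] at hadd
      exact if_congr (by omega) rfl rfl
    · rw [if_neg h, if_neg h]
  rw [Finset.sum_congr rfl hterm, ← Finset.sum_filter]
  have : (Finset.powersetCard j (Finset.univ : Finset σ)).filter (· ⊆ α.support) =
      Finset.powersetCard j α.support := by
    ext t
    simp only [Finset.mem_filter, Finset.mem_powersetCard, Finset.subset_univ, true_and]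
    exact and_comm
  rw [this, Finset.sum_const, Finset.card_powersetCard, nsmul_eq_mul, mul_ite, mul_one, mul_zero]

theorem card_support_le_degree {σ : Type*} (α : σ →₀ ℕ) : α.support.card ≤ α.degree := by
  rw [Finsupp.degree_apply, Finset.card_eq_sum_ones]
  exact Finset.sum_le_sum fun i hi => Nat.one_le_iff_ne_zero.2 (Finsupp.mem_support_iff.1 hi)

/-- `∑ (-1)^j e_j h_{n-j} = 0` for `n > 0`: coefficientwise, this is an alternating sum of
binomial coefficients. -/
theorem sum_neg_one_pow_mul_esymm_mul_hsymm (R : Type*) [CommRing R] (k n : ℕ) :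
    ∑ j ∈ Finset.range (k + 1), (if j ≤ n then
      (-1) ^ j * (esymm (Fin k) R j * hsymm (Fin k) R (n - j)) else 0) =
      if n = 0 then 1 else 0 := by
  ext α
  have hsupp := card_support_le_degree α
  have hk : α.support.card ≤ k := by simpa using Finset.card_le_univ α.support
  have hterm : ∀ j, coeff α (if j ≤ n then
      (-1) ^ j * (esymm (Fin k) R j * hsymm (Fin k) R (n - j)) else 0) =
      if α.degree = n then (((-1) ^ j * (α.support.card.choose j : ℤ) : ℤ) : R) else 0 := by
    intro j
    have hC : ((-1) ^ j : MvPolynomial (Fin k) R) = C ((-1) ^ j) := by simp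
    split_ifs with h1 h2 h2
    · rw [hC, coeff_C_mul, coeff_esymm_mul_hsymm, if_pos (by omega)]
      push_cast; rfl
    · rw [hC, coeff_C_mul, coeff_esymm_mul_hsymm, if_neg (by omega), mul_zero]
    · rw [Nat.choose_eq_zero_of_lt (by omega)]; simp
    · simp
  rw [coeff_sum, Finset.sum_congr rfl fun j _ => hterm j]
  by_cases hα : α.degree = n
  · simp only [hα, if_true]
    rw [← Int.cast_sum]
    have hsub : Finset.range (α.support.card + 1) ⊆ Finset.range (k + 1) :=
      Finset.range_subset_range.2 (by omega)
    rw [← Finset.sum_subset hsub fun j _ hj => by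
      rw [Nat.choose_eq_zero_of_lt (by simpa using hj)]; simp, Int.alternating_sum_range_choose]
    by_cases hn : n = 0
    · have : α = 0 := by rwa [hn, Finsupp.degree_eq_zero_iff] at hα
      subst this
      simp [hn]
    · have : α.support.card ≠ 0 := by
        rw [Finset.card_ne_zero, Finsupp.support_nonempty_iff]
        rintro rfl
        exact hn (by simpa using hα.symm)
      simp [hn, this]
  · simp only [hα, if_false, Finset.sum_const_zero]
    split_ifs with hn
    · rw [coeff_one, if_neg]
      rintro rfl
      exact hα (by simp [hn])
    · simp

/-! ### Weighted isobaric polynomials in the variables `x_i` -/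

section Isobaric

variable {R : Type*} [CommRing R] {k : ℕ}

theorem coeff_weightedIsobaric (n : ℕ) (ω : Fin k → R) (α : Fin k →₀ ℕ) :
    coeff α (weightedIsobaric k n ω) =
      if ∑ j : Fin k, ((j : ℕ) + 1) * α j = n then latticeWeight ω α else 0 := by
  simp only [weightedIsobaric, coeff_sum, coeff_monomial, Finset.sum_ite_eq', mem_isobaricExponents]

theorem latticeWeight_zero (ω : Fin k → R) : latticeWeight ω 0 = 0 := by
  rw [latticeWeight]; simp

theorem single_one_le_of_mem_support {α : Fin k →₀ ℕ} {j : Fin k} (hj : j ∈ α.support) :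
    Finsupp.single j 1 ≤ α := by
  rw [Finsupp.single_le_iff]
  exact Nat.one_le_iff_ne_zero.2 (Finsupp.mem_support_iff.1 hj)

theorem sum_mul_sub_single (α : Fin k →₀ ℕ) {j : Fin k} (hj : j ∈ α.support) :
    ∑ i : Fin k, ((i : ℕ) + 1) * (α - Finsupp.single j 1 : Fin k →₀ ℕ) i + (j + 1) =
      ∑ i : Fin k, ((i : ℕ) + 1) * α i := by
  have hle := single_one_le_of_mem_support hj
  conv_rhs => rw [← tsub_add_cancel_of_le hle]
  simp [mul_add, Finset.sum_add_distrib, Finsupp.single_apply]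

/-- The recursion `P_n = ω_n t_n + ∑ t_j P_{n-j}`, where `j ≤ n`. The term `j = n` needs no
exception: the coefficient of `t^0` given by the definition is an empty sum, so `P_0 = 0`. -/
theorem weightedIsobaric_eq (n : ℕ) (ω : Fin k → R) :
    weightedIsobaric k n ω =
      (∑ j : Fin k, if (j : ℕ) + 1 ≤ n then X j * weightedIsobaric k (n - (j + 1)) ω else 0) +
        ∑ j : Fin k, if (j : ℕ) + 1 = n then C (ω j) * X j else 0 := by
  ext α
  have h1 : ∀ j : Fin k, coeff α (if (j : ℕ) + 1 ≤ n then
      X j * weightedIsobaric k (n - (j + 1)) ω else 0) =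
      if j ∈ α.support then (if ∑ i : Fin k, ((i : ℕ) + 1) * α i = n then
        latticeWeight ω (α - Finsupp.single j 1) else 0) else 0 := by
    intro j
    by_cases hj : j ∈ α.support
    · have hs := sum_mul_sub_single α hj
      rw [if_pos hj]
      by_cases hn : (j : ℕ) + 1 ≤ n
      · rw [if_pos hn, coeff_X_mul', if_pos hj, coeff_weightedIsobaric]
        exact if_congr (by omega) rfl rfl
      · rw [if_neg hn, coeff_zero, if_neg (by omega)]
    · rw [if_neg hj]
      split_ifs
      · rw [coeff_X_mul', if_neg hj]
      · exact coeff_zero _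
  have h2 : ∀ j : Fin k, coeff α (if (j : ℕ) + 1 = n then C (ω j) * X j else 0) =
      if Finsupp.single j 1 = α then (if (j : ℕ) + 1 = n then ω j else 0) else 0 := by
    intro j
    split_ifs with ha hb hb <;> simp [coeff_X, *]
  rw [coeff_add, coeff_sum, coeff_sum, coeff_weightedIsobaric]
  simp only [h1, h2]
  rw [← Finset.sum_filter, Finset.filter_univ_mem]
  by_cases hα : α.degree = 1
  · obtain ⟨i, rfl⟩ : ∃ i, α = Finsupp.single i 1 := by
      obtain ⟨i, hi⟩ : α.support.Nonempty := by
        rw [Finsupp.support_nonempty_iff]; rintro rfl; simp at hα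
      have hadd := tsub_add_cancel_of_le (single_one_le_of_mem_support hi)
      have hdeg := congrArg Finsupp.degree hadd
      rw [map_add, Finsupp.degree_single, hα, Nat.add_eq_right, Finsupp.degree_eq_zero_iff] at hdeg
      rw [hdeg, zero_add] at hadd
      exact ⟨i, hadd.symm⟩
    have hw : ∑ j : Fin k, ((j : ℕ) + 1) * Finsupp.single i 1 j = (i : ℕ) + 1 := by
      simp [Finsupp.single_apply]
    rw [hw, latticeWeight, if_pos hα, Finsupp.support_single i one_ne_zero]
    simp [latticeWeight_zero, Finsupp.single_left_inj]
  · have hz : ∀ j : Fin k, Finsupp.single j 1 ≠ α := by rintro j rfl; simp at hα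
    simp only [hz, if_false, Finset.sum_const_zero, add_zero]
    split_ifs
    · rw [latticeWeight, if_neg hα, Finset.sum_coe_sort α.support
        (fun j => latticeWeight ω (α - Finsupp.single j 1))]
    · simp

/-- Under `t_j ↦ (-1)^(j+1) e_j` the polynomial `P_{k,n,ω}` becomes
`∑ (-1)^(j+1) ω_j e_j h_{n-j}`. In generating functions, the recursion reads
`P (1 - ∑ t_j z^j) = ∑ ω_j t_j z^j`, and `1 - ∑ t_j z^j` becomes `∑ (-1)^j e_j z^j`, whose inverse
is `∑ h_m z^m`. -/
theorem aeval_weightedIsobaric (n : ℕ) (ω : Fin k → R) :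
    aeval (fun j : Fin k => (-1) ^ (j : ℕ) * esymm (Fin k) R (j + 1)) (weightedIsobaric k n ω) =
      ∑ j : Fin k, if (j : ℕ) + 1 ≤ n then
        C (ω j) * ((-1) ^ (j : ℕ) * (esymm (Fin k) R (j + 1) * hsymm (Fin k) R (n - (j + 1))))
      else 0 := by
  set φ : MvPolynomial (Fin k) R →ₐ[R] MvPolynomial (Fin k) R :=
    aeval fun j : Fin k => (-1) ^ (j : ℕ) * esymm (Fin k) R (j + 1) with hφ
  set a : Fin k → MvPolynomial (Fin k) R :=
    fun j => (-1) ^ (j : ℕ) * esymm (Fin k) R (j + 1) with ha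
  have hφX : ∀ j, φ (X j) = a j := fun j => aeval_X _ j
  have hcoeff : ∀ (f : Fin k → MvPolynomial (Fin k) R) (F : PowerSeries (MvPolynomial (Fin k) R))
      (n : ℕ), PowerSeries.coeff n
        ((∑ j : Fin k, PowerSeries.C (f j) * PowerSeries.X ^ ((j : ℕ) + 1)) * F) =
      ∑ j : Fin k, if (j : ℕ) + 1 ≤ n then f j * PowerSeries.coeff (n - (j + 1)) F else 0 := by
    intro f F n
    rw [Finset.sum_mul, map_sum]
    refine Finset.sum_congr rfl fun j _ => ?_
    rw [mul_assoc, PowerSeries.coeff_C_mul, PowerSeries.coeff_X_pow_mul', mul_ite, mul_zero]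
  set A : PowerSeries (MvPolynomial (Fin k) R) :=
    ∑ j : Fin k, PowerSeries.C (a j) * PowerSeries.X ^ ((j : ℕ) + 1) with hA
  set W : PowerSeries (MvPolynomial (Fin k) R) :=
    ∑ j : Fin k, PowerSeries.C (C (ω j) * a j) * PowerSeries.X ^ ((j : ℕ) + 1) with hW
  set H : PowerSeries (MvPolynomial (Fin k) R) := PowerSeries.mk fun m => hsymm (Fin k) R m with hH
  set Q : PowerSeries (MvPolynomial (Fin k) R) :=
    PowerSeries.mk fun m => φ (weightedIsobaric k m ω) with hQ
  have hWc : ∀ n, PowerSeries.coeff n W =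
      ∑ j : Fin k, if (j : ℕ) + 1 = n then C (ω j) * a j else 0 := by
    intro n
    rw [← mul_one W, hW, hcoeff]
    refine Finset.sum_congr rfl fun j _ => ?_
    rw [PowerSeries.coeff_one]
    split_ifs <;> first | omega | simp
  have hQA : Q = A * Q + W := by
    ext1 n
    rw [map_add, hWc, hA, hcoeff]
    simp only [hQ, PowerSeries.coeff_mk]
    rw [weightedIsobaric_eq, map_add, map_sum, map_sum]
    congr 1 <;> refine Finset.sum_congr rfl fun j _ => ?_
    · split_ifs
      · rw [map_mul, hφX]
      · exact map_zero _
    · split_ifs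
      · rw [map_mul, hφX, ← algebraMap_eq, AlgHom.commutes]
      · exact map_zero _
  have hHA : (1 - A) * H = 1 := by
    ext1 n
    rw [sub_mul, one_mul, map_sub, hA, hcoeff, PowerSeries.coeff_one,
      ← sum_neg_one_pow_mul_esymm_mul_hsymm R k n, Finset.sum_range_succ', Finset.sum_range,
      add_comm, if_pos (Nat.zero_le n), esymm_zero, sub_eq_add_neg, ← Finset.sum_neg_distrib]
    simp only [hH, PowerSeries.coeff_mk]
    congr 1
    · simp
    · refine Finset.sum_congr rfl fun j _ => ?_
      split_ifs
      · rw [ha]; ring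
      · exact neg_zero
  have hQW : Q = W * H := by
    linear_combination H * hQA - Q * hHA
  have := congrArg (PowerSeries.coeff n) hQW
  rw [hW, hcoeff] at this
  simp only [hQ, hH, PowerSeries.coeff_mk] at this
  rw [this]
  refine Finset.sum_congr rfl fun j _ => if_congr Iff.rfl ?_ rfl
  rw [ha]; ring

/-- The coefficient of `x^α` in the image of `P_{k,n,ω}` under `t_j ↦ (-1)^(j+1) e_j` depends only
on the degree of `α` and on the size of its support. -/
theorem coeff_aeval_weightedIsobaric (n : ℕ) (ω : Fin k → R) (α : Fin k →₀ ℕ) :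
    coeff α (aeval (fun j : Fin k => (-1) ^ (j : ℕ) * esymm (Fin k) R (j + 1))
      (weightedIsobaric k n ω)) =
      if α.degree = n then
        ∑ j : Fin k, ω j * ((-1) ^ (j : ℕ) * (α.support.card.choose (j + 1) : R)) else 0 := by
  have hsupp := card_support_le_degree α
  rw [aeval_weightedIsobaric, coeff_sum]
  trans ∑ j : Fin k, if α.degree = n then
      ω j * ((-1) ^ (j : ℕ) * (α.support.card.choose (j + 1) : R)) else 0
  swap
  · split_ifs <;> simp
  refine Finset.sum_congr rfl fun j _ => ?_
  have hC : ((-1) ^ (j : ℕ) : MvPolynomial (Fin k) R) = C ((-1) ^ (j : ℕ)) := by simp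
  split_ifs with h1 h2 h2
  · rw [coeff_C_mul, hC, coeff_C_mul, coeff_esymm_mul_hsymm, if_pos (by omega)]
  · rw [coeff_C_mul, hC, coeff_C_mul, coeff_esymm_mul_hsymm, if_neg (by omega)]; simp
  · rw [Nat.choose_eq_zero_of_lt (by omega)]; simp
  · exact coeff_zero _

/-- Equality with the Schur reflect may be tested on coefficients in the variables `x_i`, because
the reflection is the inverse of an evaluation map. -/
theorem schurReflect_eq_weightedIsobaric_iff (n : ℕ) (μ : YoungDiagram) (ω : Fin k → R) :
    schurReflect R k μ = weightedIsobaric k n ω ↔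
      ∀ α : Fin k →₀ ℕ, coeff α (schurPoly R k μ) = if α.degree = n then
        ∑ j : Fin k, ω j * ((-1) ^ (j : ℕ) * (α.support.card.choose (j + 1) : R)) else 0 := by
  have hsymm : ∀ p : MvPolynomial (Fin k) R, ((reflection R k).symm p : MvPolynomial (Fin k) R) =
      aeval (fun j : Fin k => (-1) ^ (j : ℕ) * esymm (Fin k) R (j + 1)) p := by
    have : (symmetricSubalgebra (Fin k) R).val.comp (reflection R k).symm.toAlgHom =
        aeval (fun j : Fin k => (-1) ^ (j : ℕ) * esymm (Fin k) R (j + 1)) := by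
      ext1 j
      have hX : X j = reflection R k ((-1) ^ (j : ℕ) *
          ⟨esymm (Fin k) R (j + 1), esymm_isSymmetric (Fin k) R _⟩) := by
        rw [map_mul, reflection_esymm, map_pow, map_neg, map_one, ← mul_assoc, ← mul_pow]
        simp
      rw [aeval_X, hX]
      simp
    exact fun p => DFunLike.congr_fun this p
  rw [schurReflect, ← AlgEquiv.eq_symm_apply, Subtype.ext_iff, hsymm, MvPolynomial.ext_iff]
  simp only [coeff_aeval_weightedIsobaric]

end Isobaric

/-! ### Coefficients of Schur polynomials -/

/-- The multiset of the entries of a tableau. -/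
def entries {μ : YoungDiagram} (T : SemistandardYoungTableau μ) : Multiset ℕ :=
  μ.cells.val.map fun c => T c.1 c.2

theorem count_entries {μ : YoungDiagram} (T : SemistandardYoungTableau μ) (v : ℕ) :
    (entries T).count v = content T v := by
  rw [entries, Multiset.count_map, content, Finset.card_def, Finset.filter_val]
  simp only [eq_comm]

theorem count_map_val {k : ℕ} (α : Fin k →₀ ℕ) (v : Fin k) :
    ((Finsupp.toMultiset α).map Fin.val).count (v : ℕ) = α v := by
  rw [Multiset.count_map_eq_count' _ _ Fin.val_injective, Finsupp.count_toMultiset]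

theorem count_map_val_of_le {k v : ℕ} (α : Fin k →₀ ℕ) (hv : k ≤ v) :
    ((Finsupp.toMultiset α).map Fin.val).count v = 0 := by
  rw [Multiset.count_eq_zero, Multiset.mem_map]
  rintro ⟨a, _, rfl⟩
  exact absurd a.2 (not_lt.2 hv)

/-- The coefficient of `x^α` in a Schur polynomial is a Kostka number. The bound on the entries of
the tableaux may be dropped, as it follows from their content. -/
theorem coeff_schurPoly (R : Type*) [CommRing R] (k : ℕ) (μ : YoungDiagram) (α : Fin k →₀ ℕ) :
    coeff α (schurPoly R k μ) =
      (Nat.card {T : SemistandardYoungTableau μ //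
        entries T = (Finsupp.toMultiset α).map Fin.val} : R) := by
  classical
  have hiff : ∀ T : BoundedSSYT k μ, (∀ v : Fin k, content T.1 v = α v) ↔
      entries T.1 = (Finsupp.toMultiset α).map Fin.val := by
    intro T
    constructor
    · intro h
      ext v
      by_cases hv : v < k
      · rw [count_entries, count_map_val α ⟨v, hv⟩, ← h]
      · rw [count_map_val_of_le α (not_lt.1 hv), Multiset.count_eq_zero, entries, Multiset.mem_map]
        rintro ⟨c, hc, rfl⟩
        exact hv (T.2 ⟨c, hc⟩)
    · intro h v
      rw [← count_entries, h, count_map_val]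
  have hterm : ∀ T : BoundedSSYT k μ,
      coeff α (∏ c : μ.cells, X ⟨T.1 c.1.1 c.1.2, T.2 c⟩ : MvPolynomial (Fin k) R) =
        if entries T.1 = (Finsupp.toMultiset α).map Fin.val then 1 else 0 := by
    intro T
    have hmon : (∏ v : Fin k, X v ^ content T.1 v : MvPolynomial (Fin k) R) =
        monomial (Finsupp.equivFunOnFinite.symm fun v : Fin k => content T.1 v) 1 := by
      rw [monomial_eq, map_one, one_mul, Finsupp.prod_fintype _ _ (by simp)]
      rfl
    rw [prod_eq_content, hmon, coeff_monomial]
    refine if_congr ?_ rfl rfl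
    rw [← hiff, DFunLike.ext_iff]
    rfl
  rw [schurPoly, coeff_sum, Finset.sum_congr rfl fun T _ => hterm T, Finset.sum_boole,
    ← Fintype.card_subtype, ← Nat.card_eq_fintype_card]
  congr 1
  refine Nat.card_congr
    { toFun := fun T => ⟨T.1.1, T.2⟩
      invFun := fun T => ⟨⟨T.1, fun c => ?_⟩, T.2⟩
      left_inv := fun _ => rfl
      right_inv := fun _ => rfl }
  have hc : T.1 c.1.1 c.1.2 ∈ entries T.1 := Multiset.mem_map.2 ⟨c.1, c.2, rfl⟩
  rw [T.2, Multiset.mem_map] at hc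
  obtain ⟨a, _, ha⟩ := hc
  exact ha ▸ a.2

/-! ### Hook tableaux -/

section Hook

variable {μ : YoungDiagram} {p q : ℕ}

theorem mem_hook (hμ : μ.rowLens = p :: List.replicate q 1) {i j : ℕ} :
    (i, j) ∈ μ ↔ (i = 0 ∧ j < p) ∨ (1 ≤ i ∧ i ≤ q ∧ j = 0) := by
  have hlen : μ.colLen 0 = q + 1 := by
    rw [← YoungDiagram.length_rowLens, hμ]; simp
  by_cases hi : i < q + 1
  · have hget := YoungDiagram.get_rowLens (μ := μ) (i := i)
      (h := by rw [YoungDiagram.length_rowLens]; omega)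
    rw [YoungDiagram.mem_iff_lt_rowLen, ← hget]
    simp only [hμ]
    cases i with
    | zero => simp
    | succ i => simp; omega
  · constructor
    · intro h
      have := YoungDiagram.mem_iff_lt_colLen.1 (μ.up_left_mem le_rfl (Nat.zero_le j) h)
      omega
    · omega

theorem entries_hook (hμ : μ.rowLens = p :: List.replicate q 1) (T : SemistandardYoungTableau μ) :
    entries T = (Multiset.range p).map (fun j => T 0 j) +
      (Multiset.range q).map (fun i => T (i + 1) 0) := by
  let arm : ℕ ↪ ℕ × ℕ := ⟨fun j => (0, j), fun _ _ h => (Prod.mk.inj h).2⟩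
  let leg : ℕ ↪ ℕ × ℕ := ⟨fun i => (i + 1, 0), fun _ _ h => Nat.succ.inj (Prod.mk.inj h).1⟩
  have hdisj : Disjoint ((Finset.range p).map arm) ((Finset.range q).map leg) := by
    rw [Finset.disjoint_left]
    intro c h1 h2
    obtain ⟨j, _, rfl⟩ := Finset.mem_map.1 h1
    obtain ⟨i, _, h⟩ := Finset.mem_map.1 h2
    exact Nat.succ_ne_zero i (Prod.mk.inj h).1
  have hcells : μ.cells = ((Finset.range p).map arm).disjUnion ((Finset.range q).map leg) hdisj := by
    ext ⟨i, j⟩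
    rw [YoungDiagram.mem_cells, mem_hook hμ]
    simp only [Finset.mem_disjUnion, Finset.mem_map, Finset.mem_range]
    constructor
    · rintro (⟨rfl, h⟩ | ⟨h1, h2, rfl⟩)
      · exact Or.inl ⟨j, h, rfl⟩
      · exact Or.inr ⟨i - 1, by omega, Prod.ext (Nat.sub_add_cancel h1) rfl⟩
    · rintro (⟨j', h, h'⟩ | ⟨i', h, h'⟩)
      · obtain ⟨rfl, rfl⟩ := Prod.mk.inj h'
        exact Or.inl ⟨rfl, h⟩
      · obtain ⟨rfl, rfl⟩ := Prod.mk.inj h'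
        exact Or.inr ⟨by omega, by omega, rfl⟩
  rw [entries, hcells, Finset.disjUnion_val, Finset.map_val, Finset.map_val, Multiset.map_add,
    Multiset.map_map, Multiset.map_map]
  rfl

theorem strictMono_leg (hμ : μ.rowLens = p :: List.replicate q 1)
    (T : SemistandardYoungTableau μ) {i i' : ℕ} (h : i < i') (hi' : i' ≤ q) : T i 0 < T i' 0 :=
  T.col_strict h ((mem_hook hμ).2 (by omega))

/-- The set of the entries of a hook tableau below the first row. -/
def leg (q : ℕ) (T : SemistandardYoungTableau μ) : Finset ℕ :=
  (Finset.range q).image fun i => T (i + 1) 0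

theorem leg_val (hμ : μ.rowLens = p :: List.replicate q 1)
    (T : SemistandardYoungTableau μ) :
    (leg q T).val = (Multiset.range q).map fun i => T (i + 1) 0 := by
  refine Finset.image_val_of_injOn ?_
  intro i hi i' hi' h
  simp only [Finset.coe_range, Set.mem_Iio] at hi hi'
  rcases lt_trichotomy i i' with hlt | heq | hlt
  · exact absurd h (strictMono_leg hμ T (Nat.succ_lt_succ hlt) hi').ne
  · exact heq
  · exact absurd h (strictMono_leg hμ T (Nat.succ_lt_succ hlt) hi).ne'

theorem sort_leg (hμ : μ.rowLens = p :: List.replicate q 1)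
    (T : SemistandardYoungTableau μ) :
    (leg q T).val.sort = (List.range q).map fun i => T (i + 1) 0 := by
  refine List.Perm.eq_of_pairwise' (r := (· ≤ ·)) (Multiset.pairwise_sort _ _) ?_ ?_
  · rw [List.pairwise_map]
    refine List.pairwise_lt_range.imp_of_mem fun {i i'} _ hi' h => ?_
    exact (strictMono_leg hμ T (Nat.succ_lt_succ h) (List.mem_range.1 hi')).le
  · rw [← Multiset.coe_eq_coe, Multiset.sort_eq, leg_val hμ]
    rfl

theorem sort_arm (hμ : μ.rowLens = p :: List.replicate q 1)
    (T : SemistandardYoungTableau μ) :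
    (entries T - (leg q T).val).sort = (List.range p).map fun j => T 0 j := by
  refine List.Perm.eq_of_pairwise' (r := (· ≤ ·)) (Multiset.pairwise_sort _ _) ?_ ?_
  · rw [List.pairwise_map]
    refine List.pairwise_lt_range.imp_of_mem fun {i i'} _ hi' h => ?_
    exact T.row_weak h ((mem_hook hμ).2 (Or.inl ⟨rfl, List.mem_range.1 hi'⟩))
  · rw [← Multiset.coe_eq_coe, Multiset.sort_eq, leg_val hμ, entries_hook hμ,
      add_tsub_cancel_right]
    rfl

/-- The hook tableau with first row `r`, and with `l` in the first column below the corner. -/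
def hookTableau (hμ : μ.rowLens = p :: List.replicate q 1) (r l : List ℕ) (hr : r.length = p)
    (hl : l.length = q) (hrs : r.Pairwise (· ≤ ·)) (hcs : l.Pairwise (· < ·))
    (hrc : ∀ x ∈ l, r.getD 0 0 < x) : SemistandardYoungTableau μ where
  entry i j := if i = 0 then r.getD j 0 else if j = 0 then l.getD (i - 1) 0 else 0
  row_weak' := by
    intro i j1 j2 hj h
    rcases (mem_hook hμ).1 h with ⟨rfl, h⟩ | ⟨_, _, h⟩
    · rw [if_pos rfl, if_pos rfl, List.getD_eq_getElem _ _ (by omega),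
        List.getD_eq_getElem _ _ (by omega)]
      exact List.pairwise_iff_getElem.1 hrs _ _ _ _ hj
    · omega
  col_strict' := by
    intro i1 i2 j hi h
    rcases (mem_hook hμ).1 h with ⟨rfl, h⟩ | ⟨h1, h2, rfl⟩
    · omega
    · have hc2 : l.getD (i2 - 1) 0 = l[i2 - 1]'(by omega) := List.getD_eq_getElem _ _ _
      rw [if_neg (by omega : i2 ≠ 0)]
      simp only [if_true]
      rw [hc2]
      split_ifs with h0
      · exact hrc _ (List.getElem_mem _)
      · rw [List.getD_eq_getElem l _ (by omega)]
        exact List.pairwise_iff_getElem.1 hcs _ _ _ _ (by omega)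
  zeros' := by
    intro i j h
    rw [mem_hook hμ] at h
    split_ifs with h1 h2
    · exact List.getD_eq_default _ _ (by omega)
    · exact List.getD_eq_default _ _ (by omega)
    · rfl

theorem map_range_getD (l : List ℕ) : (List.range l.length).map (fun i => l.getD i 0) = l := by
  refine List.ext_getElem (by simp) fun i h1 h2 => ?_
  rw [List.getElem_map, List.getElem_range, List.getD_eq_getElem _ _ h2]

/-- A hook tableau with given entries is determined by its leg, which may be any set of `q` of the
values that occur, other than the least one, which is forced into the corner. -/
theorem card_hook_tableaux (hμ : μ.rowLens = p :: List.replicate q 1) (hp : 0 < p)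
    (M : Multiset ℕ) (hM : M.card = p + q) :
    Nat.card {T : SemistandardYoungTableau μ // entries T = M} =
      (M.toFinset.card - 1).choose q := by
  have hne : M.toFinset.Nonempty := by
    rw [Multiset.toFinset_nonempty, ← Multiset.card_pos]; omega
  set m := M.toFinset.min' hne with hm
  have hmM : m ∈ M := Multiset.mem_toFinset.1 (Finset.min'_mem _ _)
  rw [← Finset.card_erase_of_mem (Finset.min'_mem _ hne), ← Finset.card_powersetCard,
    ← Nat.card_eq_finsetCard]
  have hleg : ∀ T : {T : SemistandardYoungTableau μ // entries T = M},
      leg q T.1 ∈ Finset.powersetCard q (M.toFinset.erase m) := by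
    rintro ⟨T, rfl⟩
    rw [Finset.mem_powersetCard]
    constructor
    · intro x hx
      obtain ⟨i, hi, rfl⟩ := Finset.mem_image.1 hx
      have hi := Finset.mem_range.1 hi
      have hmem : ∀ i' j', (i', j') ∈ μ → T i' j' ∈ (entries T).toFinset := fun i' j' h =>
        Multiset.mem_toFinset.2 (Multiset.mem_map.2 ⟨(i', j'), h, rfl⟩)
      have h0 := Finset.min'_le _ _ (hmem 0 0 ((mem_hook hμ).2 (by omega)))
      have h1 := strictMono_leg hμ T (Nat.succ_pos i) hi
      exact Finset.mem_erase.2 ⟨(lt_of_le_of_lt h0 h1).ne', hmem _ _ ((mem_hook hμ).2 (by omega))⟩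
    · rw [Finset.card_def, leg_val hμ]
      simp
  refine Nat.card_eq_of_bijective (fun T => ⟨leg q T.1, hleg T⟩) ⟨?_, ?_⟩
  · rintro ⟨T, hT⟩ ⟨T', hT'⟩ h
    have h : leg q T = leg q T' := congrArg Subtype.val h
    have hc := sort_leg hμ T
    rw [h, sort_leg hμ T', List.map_inj_left] at hc
    have hr := sort_arm hμ T
    rw [h, hT, ← hT', sort_arm hμ T', List.map_inj_left] at hr
    apply Subtype.ext
    ext i j
    by_cases hij : (i, j) ∈ μ
    · rcases (mem_hook hμ).1 hij with ⟨rfl, hj⟩ | ⟨h1, h2, rfl⟩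
      · exact (hr j (List.mem_range.2 hj)).symm
      · obtain ⟨i, rfl⟩ : ∃ i', i = i' + 1 := ⟨i - 1, by omega⟩
        exact (hc i (List.mem_range.2 h2)).symm
    · rw [T.zeros hij, T'.zeros hij]
  · rintro ⟨C, hC⟩
    obtain ⟨hCm, hCq⟩ := Finset.mem_powersetCard.1 hC
    have hCM : C.val ≤ M := by
      rw [Multiset.le_iff_subset C.nodup]
      exact fun x hx => Multiset.mem_toFinset.1 (Finset.mem_of_mem_erase (hCm hx))
    have hrl : (M - C.val).sort.length = p := by
      rw [Multiset.length_sort, Multiset.card_sub hCM, hM, Finset.card_val, hCq]; omega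
    have hcl : C.sort.length = q := by rw [Finset.length_sort, hCq]
    have hrc : ∀ x ∈ C.sort, (M - C.val).sort.getD 0 0 < x := by
      intro x hx
      have hx := hCm ((Finset.mem_sort _).1 hx)
      -- The least value is not in the leg, so the first row begins with it.
      have hmC : m ∉ C := fun h => Finset.notMem_erase _ _ (hCm h)
      have hmr : m ∈ (M - C.val).sort := by
        rw [Multiset.mem_sort, ← Multiset.count_pos, Multiset.count_sub,
          Multiset.count_eq_zero_of_notMem (s := C.val) hmC, tsub_zero, Multiset.count_pos]
        exact hmM
      have h1 : (M - C.val).sort.getD 0 0 ≤ m := by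
        obtain ⟨i, hi, hmi⟩ := List.getElem_of_mem hmr
        rw [List.getD_eq_getElem _ _ (by omega), ← hmi]
        rcases Nat.eq_zero_or_pos i with rfl | hpos
        · exact le_rfl
        · exact List.pairwise_iff_getElem.1 (Multiset.pairwise_sort (M - C.val) (· ≤ ·)) _ _ _ _ hpos
      have h2 : m < x := lt_of_le_of_ne (Finset.min'_le _ _ (Finset.mem_of_mem_erase hx))
        (Finset.ne_of_mem_erase hx).symm
      omega
    let T := hookTableau hμ _ _ hrl hcl (Multiset.pairwise_sort _ _)
      (Finset.sortedLT_sort C).pairwise hrc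
    have hcol : (Multiset.range q).map (fun i => T (i + 1) 0) = C.val := by
      have h := map_range_getD (C.sort (· ≤ ·))
      rw [hcl] at h
      exact (congrArg _ h).trans (Finset.sort_eq C (· ≤ ·))
    have hrow : (Multiset.range p).map (fun j => T 0 j) = M - C.val := by
      have h := map_range_getD ((M - C.val).sort (· ≤ ·))
      rw [hrl] at h
      exact (congrArg _ h).trans (Multiset.sort_eq (M - C.val) (· ≤ ·))
    refine ⟨⟨T, ?_⟩, Subtype.ext (Finset.val_injective ?_)⟩
    · rw [entries_hook hμ, hcol, hrow, tsub_add_cancel_of_le hCM]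
    · exact (leg_val hμ T).trans hcol

end Hook

/-! ### The content `μ` and the size of the first row -/

section Shape

variable {μ : YoungDiagram}

theorem card_eq_sum_rowLen (μ : YoungDiagram) :
    μ.card = ∑ i ∈ Finset.range (μ.colLen 0), μ.rowLen i := by
  rw [YoungDiagram.card, Finset.card_eq_sum_card_fiberwise (f := Prod.fst)
    (t := Finset.range (μ.colLen 0))]
  · exact Finset.sum_congr rfl fun i _ => (μ.rowLen_eq_card).symm
  · rintro ⟨i, j⟩ hc
    exact Finset.mem_coe.2 (Finset.mem_range.2
      (YoungDiagram.mem_iff_lt_colLen.1 (μ.up_left_mem le_rfl (Nat.zero_le _) hc)))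

theorem rowLen_pos_iff {i : ℕ} : 0 < μ.rowLen i ↔ i < μ.colLen 0 := by
  rw [← YoungDiagram.mem_iff_lt_rowLen, YoungDiagram.mem_iff_lt_colLen]

theorem colLen_zero_pos (h0 : 0 < μ.card) : 0 < μ.colLen 0 := by
  refine Nat.pos_of_ne_zero fun h => ?_
  rw [card_eq_sum_rowLen, h, Finset.range_zero, Finset.sum_empty] at h0
  exact lt_irrefl 0 h0

theorem le_entry (T : SemistandardYoungTableau μ) {i j : ℕ} (h : (i, j) ∈ μ) : i ≤ T i j := by
  induction i with
  | zero => exact Nat.zero_le _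
  | succ i ih =>
    have := ih (μ.up_left_mem (Nat.le_succ i) le_rfl h)
    have := T.col_strict (Nat.lt_add_one i) h
    omega

/-- In a tableau with the entries of the highest weight tableau, each entry is at least its row
index, and these bounds are attained because they have the same sum as the entries. -/
theorem eq_highestWeight_of_entries_eq (T : SemistandardYoungTableau μ)
    (h : entries T = entries (SemistandardYoungTableau.highestWeight μ)) :
    T = SemistandardYoungTableau.highestWeight μ := by
  have hH : ∀ c ∈ μ.cells, SemistandardYoungTableau.highestWeight μ c.1 c.2 = c.1 := fun c hc => by
    rw [SemistandardYoungTableau.highestWeight_apply, if_pos ((YoungDiagram.mem_cells _).1 hc)]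
  have hsum : ∑ c ∈ μ.cells, c.1 = ∑ c ∈ μ.cells, T c.1 c.2 := by
    rw [← Finset.sum_congr rfl hH]
    exact congrArg Multiset.sum h.symm
  rw [Finset.sum_eq_sum_iff_of_le fun c hc => le_entry T ((YoungDiagram.mem_cells _).1 hc)] at hsum
  ext i j
  by_cases hc : (i, j) ∈ μ
  · exact (hsum _ hc).symm.trans (hH (i, j) hc).symm
  · rw [T.zeros hc, SemistandardYoungTableau.zeros _ hc]

theorem content_highestWeight (v : ℕ) :
    content (SemistandardYoungTableau.highestWeight μ) v = μ.rowLen v := by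
  rw [content, YoungDiagram.rowLen_eq_card, YoungDiagram.row]
  congr 1
  refine Finset.filter_congr fun c hc => ?_
  rw [SemistandardYoungTableau.highestWeight_apply, if_pos ((YoungDiagram.mem_cells _).1 hc)]

theorem content_zero_le (T : SemistandardYoungTableau μ) : content T 0 ≤ μ.rowLen 0 := by
  rw [content, YoungDiagram.rowLen_eq_card, YoungDiagram.row]
  refine Finset.card_le_card fun c hc => ?_
  rw [Finset.mem_filter] at hc ⊢
  have := le_entry T ((YoungDiagram.mem_cells _).1 hc.1)
  exact ⟨hc.1, by omega⟩

/-- A partition that is not a hook has a first part smaller than that of the hook with the same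
size and the same number of parts. -/
theorem rowLen_add_colLen_le_card (h0 : 0 < μ.card) (hμ : ¬ IsHook μ) :
    μ.rowLen 0 + μ.colLen 0 ≤ μ.card := by
  have hcard := card_eq_sum_rowLen μ
  obtain ⟨q, hq⟩ := Nat.exists_eq_succ_of_ne_zero (colLen_zero_pos h0).ne'
  rw [hq, Finset.sum_range_succ'] at hcard
  have hpos : ∀ i ∈ Finset.range q, 1 ≤ μ.rowLen (i + 1) := fun i hi =>
    rowLen_pos_iff.2 (by have := Finset.mem_range.1 hi; omega)
  have hle := Finset.sum_le_sum hpos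
  by_contra hlt
  refine hμ ⟨μ.rowLen 0, q, rowLen_pos_iff.2 (by omega), ?_⟩
  rw [Finset.sum_const, Finset.card_range, smul_eq_mul, mul_one] at hle
  have heq : ∑ i ∈ Finset.range q, 1 = ∑ i ∈ Finset.range q, μ.rowLen (i + 1) := by
    rw [Finset.sum_const, Finset.card_range, smul_eq_mul, mul_one]; omega
  rw [Finset.sum_eq_sum_iff_of_le hpos] at heq
  refine List.ext_getElem (by simp [hq]) fun i h1 h2 => ?_
  rw [YoungDiagram.get_rowLens]
  cases i with
  | zero => rfl
  | succ i =>
    simp only [List.length_cons, List.length_replicate] at h2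
    rw [List.getElem_cons_succ, List.getElem_replicate]
    exact (heq i (Finset.mem_range.2 (by omega))).symm

end Shape

/-! ### Comparison of coefficients -/

/-- A telescoping sum, by Pascal's rule. -/
theorem sum_neg_one_pow_choose (R : Type*) [CommRing R] (m q k : ℕ) (hk : m < k) :
    ∑ j : Fin k, (if q ≤ (j : ℕ) then (-1 : R) ^ q else 0) *
      ((-1) ^ (j : ℕ) * ((m + 1).choose (j + 1) : R)) = (m.choose q : R) := by
  rw [← Finset.sum_range fun j => (if q ≤ j then (-1 : R) ^ q else 0) *
    ((-1) ^ j * ((m + 1).choose (j + 1) : R))]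
  have h : ∀ k, ∑ j ∈ Finset.range k, (if q ≤ j then (-1 : R) ^ q else 0) *
      ((-1) ^ j * ((m + 1).choose (j + 1) : R)) =
      if q ≤ k then (m.choose q : R) - (-1) ^ q * (-1) ^ k * (m.choose k : R) else 0 := by
    intro k
    have hsq : (-1 : R) ^ q * (-1) ^ q = 1 := by rw [← mul_pow]; simp
    induction k with
    | zero =>
      by_cases hq : q = 0 <;> simp [hq]
    | succ k ih =>
      rw [Finset.sum_range_succ, ih, Nat.choose_succ_succ]
      push_cast
      by_cases h1 : q ≤ k
      · rw [if_pos h1, if_pos h1, if_pos (by omega)]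
        ring
      · by_cases h2 : q = k + 1
        · subst h2
          rw [if_neg h1, if_neg h1, if_pos le_rfl, hsq]
          ring
        · rw [if_neg h1, if_neg h1, if_neg (by omega)]
          ring
  rw [h, Nat.choose_eq_zero_of_lt hk]
  split_ifs with hq
  · simp
  · rw [Nat.choose_eq_zero_of_lt (by omega), Nat.cast_zero]

/-- For the index `j : Fin k` of the variable number `j + 1`, the condition `j + 1 > q` on the
weights reads `q ≤ j`. -/
theorem schurReflect_hook (R : Type*) [CommRing R] (k : ℕ) {μ : YoungDiagram} {p q : ℕ}
    (hp : 0 < p) (hμ : μ.rowLens = p :: List.replicate q 1) :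
    schurReflect R k μ = weightedIsobaric k μ.card
      (fun j : Fin k => if q ≤ (j : ℕ) then (-1 : R) ^ q else 0) := by
  have hcard : ∀ T : SemistandardYoungTableau μ, (entries T).card = μ.card := fun T =>
    Multiset.card_map _ _
  have hpq : μ.card = p + q := by
    rw [← hcard (SemistandardYoungTableau.highestWeight μ), entries_hook hμ]
    simp
  rw [schurReflect_eq_weightedIsobaric_iff]
  intro α
  have hαcard : ((Finsupp.toMultiset α).map Fin.val).card = α.degree := by
    rw [Multiset.card_map, Finsupp.card_toMultiset, Finsupp.degree_apply]
    rfl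
  rw [coeff_schurPoly]
  split_ifs with hα
  · have hsupp : ((Finsupp.toMultiset α).map Fin.val).toFinset.card = α.support.card := by
      rw [Multiset.toFinset_map, Finset.card_image_of_injective _ Fin.val_injective,
        Finsupp.toFinset_toMultiset]
    obtain ⟨m, hm⟩ : ∃ m, α.support.card = m + 1 := by
      refine Nat.exists_eq_succ_of_ne_zero ?_
      rw [Finset.card_ne_zero, Finsupp.support_nonempty_iff]
      rintro rfl
      rw [map_zero] at hα
      omega
    have hmk : m < k := by
      have := Finset.card_le_univ α.support
      rw [Fintype.card_fin] at this
      omega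
    rw [card_hook_tableaux hμ hp _ (by rw [hαcard, hα, hpq]), hsupp, hm, Nat.add_sub_cancel,
      sum_neg_one_pow_choose R m q k hmk]
  · have : IsEmpty {T : SemistandardYoungTableau μ //
        entries T = (Finsupp.toMultiset α).map Fin.val} :=
      ⟨fun T => hα (by rw [← hαcard, ← T.2, hcard])⟩
    rw [Nat.card_of_isEmpty, Nat.cast_zero]

theorem isHook_of_schurReflect_eq (R : Type*) [CommRing R] [Nontrivial R] {k : ℕ}
    {μ : YoungDiagram} (h0 : 0 < μ.card) (hk : μ.colLen 0 ≤ k) (ω : Fin k → R)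
    (h : schurReflect R k μ = weightedIsobaric k μ.card ω) : IsHook μ := by
  by_contra hμ
  rw [schurReflect_eq_weightedIsobaric_iff] at h
  have hlt := rowLen_add_colLen_le_card h0 hμ
  obtain ⟨q, hq⟩ := Nat.exists_eq_succ_of_ne_zero (colLen_zero_pos h0).ne'
  -- The exponent `μ`, which is the content of exactly one tableau.
  let α : Fin k →₀ ℕ := Finsupp.equivFunOnFinite.symm fun v => μ.rowLen v
  -- The exponent of the same degree and the same support with entries `(μ.card - q, 1, …, 1)`.
  let β : Fin k →₀ ℕ := Finsupp.equivFunOnFinite.symm fun v =>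
    if (v : ℕ) = 0 then μ.card - q else if (v : ℕ) ≤ q then 1 else 0
  have hα : α.degree = μ.card := by
    rw [card_eq_sum_rowLen, Finsupp.degree_eq_sum]
    change ∑ v : Fin k, μ.rowLen v = _
    rw [← Finset.sum_range fun v => μ.rowLen v]
    refine (Finset.sum_subset (Finset.range_subset_range.2 hk) fun v _ hv => ?_).symm
    have := (rowLen_pos_iff (μ := μ) (i := v)).not
    rw [Finset.mem_range] at hv
    omega
  have hβ : β.degree = μ.card := by
    rw [Finsupp.degree_eq_sum]
    change ∑ v : Fin k, (if (v : ℕ) = 0 then μ.card - q else if (v : ℕ) ≤ q then 1 else 0) = _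
    rw [← Finset.sum_range fun v => if v = 0 then μ.card - q else if v ≤ q then 1 else 0,
      ← Finset.sum_subset (Finset.range_subset_range.2 (hq ▸ hk)) fun v _ hv => by
        rw [Finset.mem_range] at hv
        rw [if_neg (by omega), if_neg (by omega)],
      Finset.sum_range_succ', if_pos rfl, Finset.sum_congr rfl (g := fun _ => 1) fun v hv => by
        rw [Finset.mem_range] at hv
        rw [if_neg (by omega), if_pos (by omega)]]
    simp
    omega
  have hsupp : α.support = β.support := by
    ext v
    rw [Finsupp.mem_support_iff, Finsupp.mem_support_iff]
    change μ.rowLen v ≠ 0 ↔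
      (if (v : ℕ) = 0 then μ.card - q else if (v : ℕ) ≤ q then 1 else 0) ≠ 0
    rw [← Nat.pos_iff_ne_zero, rowLen_pos_iff]
    split_ifs <;> omega
  have hSβ : coeff β (schurPoly R k μ) = 0 := by
    have : IsEmpty {T : SemistandardYoungTableau μ //
        entries T = (Finsupp.toMultiset β).map Fin.val} := by
      refine ⟨fun T => ?_⟩
      have h1 : content T.1 0 = μ.card - q := by
        rw [← count_entries, T.2]
        exact count_map_val β ⟨0, by omega⟩
      have h2 := content_zero_le T.1
      omega
    rw [coeff_schurPoly, Nat.card_of_isEmpty, Nat.cast_zero]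
  have hSα : coeff α (schurPoly R k μ) = 1 := by
    have hent : entries (SemistandardYoungTableau.highestWeight μ) =
        (Finsupp.toMultiset α).map Fin.val := by
      ext v
      rw [count_entries, content_highestWeight]
      by_cases hv : v < k
      · exact (count_map_val α ⟨v, hv⟩).symm
      · rw [count_map_val_of_le α (not_lt.1 hv)]
        have := (rowLen_pos_iff (μ := μ) (i := v)).not
        omega
    have : Unique {T : SemistandardYoungTableau μ //
        entries T = entries (SemistandardYoungTableau.highestWeight μ)} :=
      { default := ⟨_, rfl⟩
        uniq := fun T => Subtype.ext (eq_highestWeight_of_entries_eq _ T.2) }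
    rw [coeff_schurPoly, ← hent, Nat.card_unique, Nat.cast_one]
  refine one_ne_zero (α := R) ?_
  rw [← hSα, ← hSβ, h, h, if_pos hα, if_pos hβ, hsupp]

end SchurReflect

/-- The first part is about `k` variables, for each `k` at least the number of parts (with fewer
variables the Schur polynomial is zero). The second part is about infinitely many variables
`t_1, t_2, …`, where an equality means that it holds after setting `t_j = 0` for all `j > k`,
for every `k`. -/
theorem mainTheorem6 {R : Type*} [CommRing R] [Nontrivial R] (n : ℕ) (hn : 0 < n)
    (μ : YoungDiagram) (hμ : μ.card = n) :
    (∀ k : ℕ, μ.colLen 0 ≤ k →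
      ((∃ ω : Fin k → R,
        SchurReflect.schurReflect R k μ = SchurReflect.weightedIsobaric k n ω) ↔
          SchurReflect.IsHook μ)) ∧
    ((∃ ω : ℕ → R, ∀ k : ℕ,
      SchurReflect.schurReflect R k μ = SchurReflect.weightedIsobaric k n (fun j : Fin k => ω j)) ↔
        SchurReflect.IsHook μ) := by
  subst hμ
  refine ⟨fun k hk => ⟨fun ⟨ω, h⟩ => ?_, fun ⟨p, q, hp, h⟩ => ?_⟩,
    ⟨fun ⟨ω, h⟩ => ?_, fun ⟨p, q, hp, h⟩ => ?_⟩⟩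
  · exact SchurReflect.isHook_of_schurReflect_eq R hn hk ω h
  · exact ⟨_, SchurReflect.schurReflect_hook R k hp h⟩
  · exact SchurReflect.isHook_of_schurReflect_eq R hn le_rfl _ (h (μ.colLen 0))
  · exact ⟨fun j => if q ≤ j then (-1) ^ q else 0,
      fun k => SchurReflect.schurReflect_hook R k hp h⟩
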